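/- Let $d\ge 1$, $\xi>0$, $\lambda>0$. Let $G$ be a probability measure on $(0,\infty)$ whose tail function $\bar G(u)=G((u,\infty))$ is regularly varying at infinity with exponent $-\xi$, i.e. $\bar G(tx)/\bar G(x)\to t^{-\xi}$ as $x\to\infty$ for every $t>0$. Let $h:\mathbb R^d\to[0,\infty]$ be measurable, not identically zero, and suppose that there are $\gamma>d/\xi$ and $C>0$ with $$h(x)\le C\,(|x|^{-\gamma}\wedge 1),\qquad x\in\mathbb R^d$$ (with $|0|^{-\gamma}=+\infty$), where $|\cdot|$ is the Euclidean norm. Let $\Phi_\lambda$ be a Poisson point process on $\mathbb R^d\times(0,\infty)$ with intensity measure $\lambda\,dx\,G(dm)$ and let $$M_\lambda(y)=\sup\{m\,h(y-x)\;:\;(x,m)\in\Phi_\lambda\},\qquad y\in\mathbb R^d,$$ be the associated extremal shot noise. Then $\sup_{|y|\le R}M_\lambda(y)$ is almost surely finite for every $R$, and, as $R\to\infty$, $$\frac1{N(R)}\sup_{|y|\le R}M_\lambda(y)\Longrightarrow F_\xi$$ weakly, where $F_\xi$ is the Fréchet law with distribution function $F_\xi(x)=\exp(-x^{-\xi})\mathbf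 1_{\{x>0\}}$ and $$N(R)=\|h\|_\infty\, c_d^{1/\xi}\,\lambda^{1/\xi}\,G^{\leftarrow}(1-R^{-d}),$$ with $\|h\|_\infty=\sup_{x}h(x)$, $c_d$ the volume of the Euclidean unit ball of $\mathbb R^d$, and $G^{\leftarrow}(u)=\inf\{x>0: G((0,x])\ge u\}$, $0<u<1$, the quantile function of $G$. -/

import Mathlib

open MeasureTheory ProbabilityTheory Filter Topology
open scoped ENNReal NNReal

noncomputable section

namespace ShotNoise

/-- `Φ`, a random subset of `X` defined on the probability space `(Ω, P)`, is a (simple) Poisson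
point process with intensity measure `ν`: the points form a locally finite set, the number of points
in every measurable set `A` is a random variable which is Poisson distributed with mean `ν A`
(almost surely infinite if `ν A = ∞`), and the numbers of points in pairwise disjoint measurable
sets are independent. -/
structure IsPoissonPointProcess {Ω X : Type*} [MeasurableSpace Ω] [TopologicalSpace X]
    [MeasurableSpace X] (Φ : Ω → Set X) (ν : Measure X) (P : Measure Ω) : Prop where
  locallyFinite : ∀ ω, ∀ K : Set X, IsCompact K → (Φ ω ∩ K).Finite
  measurable_count : ∀ A : Set X, MeasurableSet A → Measurable fun ω => (Φ ω ∩ A).encard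
  count_law : ∀ A : Set X, MeasurableSet A → ν A ≠ ∞ →
    P.map (fun ω => (Φ ω ∩ A).encard) =
      (poissonMeasure (ν A).toNNReal).map (fun k : ℕ => (k : ℕ∞))
  count_infinite : ∀ A : Set X, MeasurableSet A → ν A = ∞ →
    ∀ᵐ ω ∂P, (Φ ω ∩ A).encard = ⊤
  indep : ∀ (n : ℕ) (A : Fin n → Set X), (∀ i, MeasurableSet (A i)) →
    Pairwise (fun i j => Disjoint (A i) (A j)) →
    iIndepFun (fun i ω => (Φ ω ∩ A i).encard) P

/-- The value at `y` of the extremal shot noise with shape function `h` built on the set `S` of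
marked points `(x, m)`, that is `sup {m * h (y - x) ; (x, m) ∈ S} ∈ [0, ∞]`. -/
def extremalShotNoise {d : ℕ} (h : EuclideanSpace ℝ (Fin d) → ℝ≥0∞)
    (S : Set (EuclideanSpace ℝ (Fin d) × Set.Ioi (0 : ℝ))) (y : EuclideanSpace ℝ (Fin d)) : ℝ≥0∞ :=
  ⨆ φ ∈ S, ENNReal.ofReal (φ.2 : ℝ) * h (y - φ.1)

/-- The tail function `u ↦ G((u, ∞))` of a measure on `(0, ∞)`. -/
def tail (G : Measure (Set.Ioi (0 : ℝ))) (u : ℝ) : ℝ :=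
  G.real {m | u < (m : ℝ)}

/-- The quantile function `u ↦ inf {x > 0 ; G((0, x]) ≥ u}` of a probability on `(0, ∞)`. -/
def quantile (G : Measure (Set.Ioi (0 : ℝ))) (u : ℝ) : ℝ :=
  sInf {x : ℝ | 0 < x ∧ u ≤ G.real {m | (m : ℝ) ≤ x}}

/-- `f` is regularly varying at infinity with exponent `ρ`. -/
structure IsRegularlyVarying (f : ℝ → ℝ) (ρ : ℝ) : Prop where
  measurable : Measurable f
  eventually_pos : ∀ᶠ x in atTop, 0 < f x
  tendsto_ratio : ∀ t : ℝ, 0 < t → Tendsto (fun x => f (t * x) / f x) atTop (𝓝 (t ^ ρ))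

/-- The decay condition: there are `γ > d / ξ` and `C > 0` such that `h x ≤ C (|x| ^ (-γ) ∧ 1)` for
all `x` (with `|0| ^ (-γ) = ∞`). -/
def DecayCondition {d : ℕ} (ξ : ℝ) (h : EuclideanSpace ℝ (Fin d) → ℝ≥0∞) : Prop :=
  ∃ γ C : ℝ, (d : ℝ) / ξ < γ ∧ 0 < C ∧
    ∀ x, h x ≤ ENNReal.ofReal C * min (‖x‖ₑ ^ (-γ)) 1

/-- The normalisation `N(R) = ‖h‖_∞ c_d^{1/ξ} λ^{1/ξ} G^←(1 - R^{-d})`, where `‖h‖_∞` is the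
supremum of `h` and `c_d` is the volume of the unit ball. -/
def normalisation {d : ℕ} (h : EuclideanSpace ℝ (Fin d) → ℝ≥0∞) (G : Measure (Set.Ioi (0 : ℝ)))
    (lam ξ R : ℝ) : ℝ :=
  (⨆ x, h x).toReal *
    (volume.real (Metric.ball (0 : EuclideanSpace ℝ (Fin d)) 1)) ^ (1 / ξ) *
    lam ^ (1 / ξ) * quantile G (1 - (R ^ d)⁻¹)

/-- The Fréchet distribution function `x ↦ exp (-x ^ (-ξ)) 1_{x > 0}`. -/
def frechetFun (ξ x : ℝ) : ℝ := if 0 < x then Real.exp (-x ^ (-ξ)) else 0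

lemma frechetFun_nonneg (ξ x : ℝ) : 0 ≤ frechetFun ξ x := by
  unfold frechetFun; split_ifs <;> positivity

lemma frechetFun_mono {ξ : ℝ} (hξ : 0 < ξ) : Monotone (frechetFun ξ) := by
  intro x y hxy
  by_cases hx : 0 < x
  · have hy : 0 < y := hx.trans_le hxy
    simp only [frechetFun, hx, hy, if_true]
    exact Real.exp_le_exp.2
      (neg_le_neg (Real.rpow_le_rpow_of_nonpos hx hxy (by linarith)))
  · have : frechetFun ξ x = 0 := by simp [frechetFun, hx]
    rw [this]; exact frechetFun_nonneg ξ y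

lemma frechetFun_rightCont {ξ : ℝ} (hξ : 0 < ξ) (x : ℝ) :
    ContinuousWithinAt (frechetFun ξ) (Set.Ici x) x := by
  rcases lt_trichotomy x 0 with hx | hx | hx
  · have : frechetFun ξ =ᶠ[𝓝 x] fun _ => 0 := by
      filter_upwards [Iio_mem_nhds hx] with y hy
      simp [frechetFun, not_lt.2 (le_of_lt (show y < 0 from hy))]
    exact (continuousAt_const.congr this.symm).continuousWithinAt
  · subst hx
    rw [← continuousWithinAt_Ioi_iff_Ici]
    have h0 : frechetFun ξ 0 = 0 := by simp [frechetFun]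
    rw [ContinuousWithinAt, h0]
    have h1 : Tendsto (fun y : ℝ => Real.exp (-y ^ (-ξ))) (𝓝[>] 0) (𝓝 0) :=
      Real.tendsto_exp_neg_atTop_nhds_zero.comp (tendsto_rpow_neg_nhdsGT_zero (by linarith))
    refine h1.congr' ?_
    filter_upwards [self_mem_nhdsWithin] with y hy
    simp only [frechetFun, if_pos (show (0 : ℝ) < y from hy)]
  · have h1 : ContinuousAt (fun y : ℝ => Real.exp (-y ^ (-ξ))) x :=
      ((Real.continuousAt_rpow_const x (-ξ) (Or.inl hx.ne')).neg).rexp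
    refine (h1.congr ?_).continuousWithinAt
    filter_upwards [Ioi_mem_nhds hx] with y hy
    simp only [frechetFun, if_pos (show (0 : ℝ) < y from hy)]

/-- The Fréchet distribution function as a Stieltjes function. -/
def frechetCDF (ξ : ℝ) (hξ : 0 < ξ) : StieltjesFunction ℝ where
  toFun := frechetFun ξ
  mono' := frechetFun_mono hξ
  right_continuous' := frechetFun_rightCont hξ

lemma frechetCDF_tendsto_atBot (ξ : ℝ) (hξ : 0 < ξ) :
    Tendsto (frechetCDF ξ hξ) atBot (𝓝 0) := by
  refine tendsto_const_nhds.congr' ?_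
  filter_upwards [Iic_mem_atBot (0 : ℝ)] with y hy
  change 0 = frechetFun ξ y
  simp [frechetFun, not_lt.2 (show y ≤ 0 from hy)]

lemma frechetCDF_tendsto_atTop (ξ : ℝ) (hξ : 0 < ξ) :
    Tendsto (frechetCDF ξ hξ) atTop (𝓝 1) := by
  have h1 : Tendsto (fun y : ℝ => Real.exp (-y ^ (-ξ))) atTop (𝓝 1) := by
    have := (tendsto_rpow_neg_atTop hξ).neg.rexp
    simpa using this
  refine h1.congr' ?_
  filter_upwards [Ioi_mem_atTop (0 : ℝ)] with y hy
  change _ = frechetFun ξ y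
  simp only [frechetFun, if_pos (show (0 : ℝ) < y from hy)]

/-- The Fréchet law: the probability on `ℝ` with distribution function `frechetFun ξ`. -/
def frechetLaw (ξ : ℝ) (hξ : 0 < ξ) : ProbabilityMeasure ℝ :=
  ⟨(frechetCDF ξ hξ).measure, (frechetCDF ξ hξ).isProbabilityMeasure
    (frechetCDF_tendsto_atBot ξ hξ) (frechetCDF_tendsto_atTop ξ hξ)⟩

end ShotNoise

end

namespace ShotNoise

/-! Interchanging suprema, the supremum of the shot noise over a ball is the supremum of `m * H x`
over the Poisson points `(x, m)`, where `H` is the supremum of the translate of `h` over the ball.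
It is at most `t` exactly when no point lies in the exceedance set `{t < m * H x}`, so its
distribution function is a void probability `exp (-Λ)`, with `Λ` the intensity of that set.
Everything reduces to `Λ → s ^ (-ξ)` at level `t = N(R) * s` (`tendsto_intensity`).

Heuristically `H` equals `‖h‖_∞` on the ball of radius `R` and is negligible outside, so `Λ` is
about `λ c_d R^d` times the tail of `G` at `t / ‖h‖_∞`; regular variation at the quantile gives the
limit. For the lower bound, one near-maximal value `h z` serves all `x` in the ball of radius `R -
‖z‖` (`le_intensity_exceedance`). For the upper bound, points within `(1 + δ) R` get the bound
`‖h‖_∞`, and a Potter bound makes the far points contribute only a constant multiple of the tail,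
because `γ > d / ξ` (`exists_intensity_exceedance_le`).

For closed balls `H` need not be Borel. For open balls it is, and the two versions agree almost
everywhere since positive level sets of a distance function are null
(`closedBallSup_ae_eq_ballSup`). -/

/-- Pointwise convergence of distribution functions at every point implies weak convergence. -/
lemma tendsto_of_forall_tendsto_Iic {ι : Type*} {l : Filter ι} [l.IsCountablyGenerated]
    {μ : ι → ProbabilityMeasure ℝ} {ν : ProbabilityMeasure ℝ}
    (H : ∀ x, Tendsto (fun i => (μ i : Measure ℝ).real (Set.Iic x)) l
      (𝓝 ((ν : Measure ℝ).real (Set.Iic x)))) :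
    Tendsto μ l (𝓝 ν) := by
  -- Half-open intervals form a π-system containing arbitrarily small neighbourhoods of each point,
  -- so convergence on them suffices.
  refine (isPiSystem_Ioc (id : ℝ → ℝ) id).tendsto_probabilityMeasure_of_tendsto_of_mem ?_ ?_ ?_
  · rintro s ⟨a, b, -, rfl⟩
    exact measurableSet_Ioc
  · intro u hu x hx
    obtain ⟨ε, hε, hsub⟩ := Metric.isOpen_iff.1 hu x hx
    refine ⟨Set.Ioc (x - ε / 2) (x + ε / 2), ⟨x - ε / 2, x + ε / 2, by simp; linarith, rfl⟩,
      Ioc_mem_nhds (by linarith) (by linarith), fun y hy => hsub ?_⟩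
    rw [Metric.mem_ball, Real.dist_eq, abs_lt]
    constructor <;> linarith [hy.1, hy.2]
  · rintro s ⟨a, b, hab, rfl⟩
    have key : ∀ ρ : ProbabilityMeasure ℝ, ((ρ (Set.Ioc a b) : ℝ≥0) : ℝ) =
        (ρ : Measure ℝ).real (Set.Iic b) - (ρ : Measure ℝ).real (Set.Iic a) := by
      intro ρ
      have hab' : a ≤ b := le_of_lt hab
      have hd : Set.Ioc a b = Set.Iic b \ Set.Iic a := by ext; simp [and_comm]
      rw [hd, ← measureReal_sdiff (μ := (ρ : Measure ℝ))
        (Set.Iic_subset_Iic.2 hab') measurableSet_Iic]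
      rfl
    rw [← NNReal.tendsto_coe]
    simp only [id, key]
    exact (H b).sub (H a)

/-! ### Regularly varying tails and their quantiles -/

section RegularVariation

variable {G : Measure (Set.Ioi (0 : ℝ))}

lemma tail_nonneg (x : ℝ) : 0 ≤ tail G x := measureReal_nonneg

variable [IsProbabilityMeasure G]

lemma tail_antitone : Antitone (tail G) := fun _ _ hxy =>
  measureReal_mono fun _ hm => lt_of_le_of_lt hxy hm

lemma measure_lt_eq_ofReal_tail (x : ℝ) :
    G {m : Set.Ioi (0 : ℝ) | x < (m : ℝ)} = ENNReal.ofReal (tail G x) := by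
  rw [tail, ofReal_measureReal]

lemma measureReal_le_eq_one_sub_tail (x : ℝ) :
    G.real {m : Set.Ioi (0 : ℝ) | (m : ℝ) ≤ x} = 1 - tail G x := by
  have hm : MeasurableSet {m : Set.Ioi (0 : ℝ) | x < (m : ℝ)} :=
    measurableSet_lt measurable_const measurable_subtype_coe
  rw [tail, ← probReal_compl_eq_one_sub hm]
  congr 1
  ext m
  simp

lemma tail_tendsto_zero : Tendsto (tail G) atTop (𝓝 0) := by
  have hm : Measurable (Subtype.val : Set.Ioi (0 : ℝ) → ℝ) := measurable_subtype_coe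
  have : IsProbabilityMeasure (G.map (Subtype.val : Set.Ioi (0 : ℝ) → ℝ)) :=
    Measure.isProbabilityMeasure_map hm.aemeasurable
  have h1 := (tendsto_cdf_atTop (G.map (Subtype.val : Set.Ioi (0 : ℝ) → ℝ))).const_sub 1
  simp only [sub_self] at h1
  refine h1.congr fun x => ?_
  rw [cdf_eq_real, map_measureReal_apply hm measurableSet_Iic]
  have := measureReal_le_eq_one_sub_tail (G := G) x
  simp only [Set.preimage, Set.mem_Iic]
  linarith

lemma tail_pos {ρ : ℝ} (hG : IsRegularlyVarying (tail G) ρ) (x : ℝ) : 0 < tail G x := by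
  obtain ⟨y, hy, hxy⟩ := (hG.eventually_pos.and (eventually_ge_atTop x)).exists
  exact hy.trans_le (tail_antitone hxy)

/-- A Potter type bound: a regularly varying antitone function of index `-ξ` decays at least as
fast as any power of exponent `-η` with `η < ξ`. -/
lemma IsRegularlyVarying.exists_potter_bound {f : ℝ → ℝ} {ξ η : ℝ}
    (hf : IsRegularlyVarying f (-ξ)) (hanti : Antitone f) (hη : 0 < η) (hηξ : η < ξ) :
    ∃ x₀ : ℝ, 0 < x₀ ∧ ∀ x, x₀ ≤ x → ∀ v : ℝ, 1 ≤ v →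
      f (v * x) ≤ 2 ^ η * v ^ (-η) * f x := by
  -- The gap between `η` and `ξ` turns the limiting ratio at `2` into a genuine inequality beyond
  -- some point, which can be iterated along dyadic multiples.
  have h2 : ((2 : ℝ) ^ (-ξ)) < 2 ^ (-η) :=
    Real.rpow_lt_rpow_of_exponent_lt (by norm_num) (by linarith)
  have hev := (((hf.tendsto_ratio 2 (by norm_num)).eventually (gt_mem_nhds h2)).and
    hf.eventually_pos)
  obtain ⟨x₁, hx₁⟩ := eventually_atTop.1 hev
  refine ⟨max x₁ 1, by positivity, fun x hx v hv => ?_⟩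
  have hx1 : x₁ ≤ x := (le_max_left _ _).trans hx
  have hx0 : 0 < x := lt_of_lt_of_le one_pos ((le_max_right _ _).trans hx)
  have step : ∀ y, x₁ ≤ y → f (2 * y) ≤ 2 ^ (-η) * f y := fun y hy => by
    obtain ⟨h1, h3⟩ := hx₁ y hy
    exact ((div_lt_iff₀ h3).1 h1).le
  have iter : ∀ k : ℕ, f (2 ^ k * x) ≤ ((2 : ℝ) ^ (-η)) ^ k * f x := by
    intro k
    induction k with
    | zero => simp
    | succ k ih =>
      have hle : x₁ ≤ 2 ^ k * x := hx1.trans (le_mul_of_one_le_left hx0.le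
        (one_le_pow₀ (by norm_num)))
      calc f (2 ^ (k + 1) * x) = f (2 * (2 ^ k * x)) := by ring_nf
        _ ≤ 2 ^ (-η) * f (2 ^ k * x) := step _ hle
        _ ≤ 2 ^ (-η) * (((2 : ℝ) ^ (-η)) ^ k * f x) := by gcongr
        _ = _ := by ring
  -- Rounding `v` down to a power of two costs at most one doubling, hence the factor `2 ^ η`.
  obtain ⟨k, hk1, hk2⟩ := exists_nat_pow_near hv (by norm_num : (1 : ℝ) < 2)
  have hfx : 0 < f x := (hx₁ x hx1).2
  calc f (v * x) ≤ f (2 ^ k * x) := hanti (by gcongr)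
    _ ≤ ((2 : ℝ) ^ (-η)) ^ k * f x := iter k
    _ ≤ 2 ^ η * v ^ (-η) * f x := by
      gcongr
      have h3 : ((2 : ℝ) ^ (k + 1)) ^ (-η) ≤ v ^ (-η) :=
        Real.rpow_le_rpow_of_nonpos (by linarith) hk2.le (by linarith)
      have h4 : ((2 : ℝ) ^ (k + 1)) ^ (-η) = ((2 : ℝ) ^ (-η)) ^ k * 2 ^ (-η) := by
        rw [← Real.rpow_natCast, ← Real.rpow_mul (by norm_num), mul_comm,
          Real.rpow_mul (by norm_num), Real.rpow_natCast, pow_succ]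
      have h5 : (2 : ℝ) ^ η * 2 ^ (-η) = 1 := by
        rw [← Real.rpow_add (by norm_num)]; simp
      calc ((2 : ℝ) ^ (-η)) ^ k = 2 ^ η * (((2 : ℝ) ^ (-η)) ^ k * 2 ^ (-η)) := by
            linear_combination (-(((2 : ℝ) ^ (-η)) ^ k)) * h5
        _ ≤ _ := by rw [← h4]; gcongr

lemma mem_quantile_set_iff {n x : ℝ} :
    (1 - n⁻¹ ≤ G.real {m : Set.Ioi (0 : ℝ) | (m : ℝ) ≤ x}) ↔ tail G x ≤ n⁻¹ := by
  rw [measureReal_le_eq_one_sub_tail]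
  constructor <;> intro h <;> linarith

lemma quantile_eq (n : ℝ) : quantile G (1 - n⁻¹) = sInf {x : ℝ | 0 < x ∧ tail G x ≤ n⁻¹} := by
  simp only [quantile, mem_quantile_set_iff]

lemma exists_tail_le {n : ℝ} (hn : 0 < n) : {x : ℝ | 0 < x ∧ tail G x ≤ n⁻¹}.Nonempty := by
  have h1 := (tail_tendsto_zero (G := G)).eventually (gt_mem_nhds (inv_pos.2 hn))
  obtain ⟨x, hx, hx0⟩ := (h1.and (eventually_gt_atTop 0)).exists
  exact ⟨x, hx0, hx.le⟩

lemma tail_le_of_quantile_lt {n x : ℝ} (hn : 0 < n) (hx : quantile G (1 - n⁻¹) < x) :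
    tail G x ≤ n⁻¹ := by
  rw [quantile_eq] at hx
  obtain ⟨y, hy, hyx⟩ := exists_lt_of_csInf_lt (exists_tail_le hn) hx
  exact (tail_antitone hyx.le).trans hy.2

lemma lt_tail_of_lt_quantile {n x : ℝ} (hx0 : 0 < x) (hx : x < quantile G (1 - n⁻¹)) :
    n⁻¹ < tail G x := by
  rw [quantile_eq] at hx
  by_contra! hle
  exact notMem_of_lt_csInf hx ⟨0, fun y hy => hy.1.le⟩ ⟨hx0, hle⟩

lemma tendsto_quantile_atTop {ρ : ℝ} (hG : IsRegularlyVarying (tail G) ρ) :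
    Tendsto (fun n : ℝ => quantile G (1 - n⁻¹)) atTop atTop := by
  refine tendsto_atTop.2 fun M => ?_
  filter_upwards [(tendsto_inv_atTop_zero (𝕜 := ℝ)).eventually (gt_mem_nhds (tail_pos hG M)),
    eventually_gt_atTop 0] with n hn hn0
  rw [quantile_eq]
  refine le_csInf (exists_tail_le hn0) fun x hx => ?_
  by_contra! hlt
  exact absurd (tail_antitone (G := G) hlt.le) (not_le.2 (hx.2.trans_lt hn))

/-- The tail may jump at the quantile, so it is compared with `n⁻¹` only at `t` times the quantile,
with `t < 1` or `t > 1`. Regular variation bounds the cost by a factor close to `t ^ ξ`, and `t → 1`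
closes the gap. -/
lemma tendsto_mul_tail_quantile {ξ : ℝ} (hG : IsRegularlyVarying (tail G) (-ξ)) :
    Tendsto (fun n : ℝ => n * tail G (quantile G (1 - n⁻¹))) atTop (𝓝 1) := by
  have hq := tendsto_quantile_atTop hG
  have hpow : ContinuousAt (fun t : ℝ => (t ^ (-ξ))⁻¹) 1 :=
    (Real.continuousAt_rpow_const 1 (-ξ) (Or.inl one_ne_zero)).inv₀ (by simp)
  have hpow1 : Tendsto (fun t : ℝ => (t ^ (-ξ))⁻¹) (𝓝 1) (𝓝 1) := by
    simpa [ContinuousAt] using hpow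
  have ratio : ∀ t : ℝ, 0 < t → Tendsto (fun n : ℝ =>
      tail G (quantile G (1 - n⁻¹)) / tail G (t * quantile G (1 - n⁻¹))) atTop
      (𝓝 ((t ^ (-ξ))⁻¹)) := fun t ht => by
    have := ((hG.tendsto_ratio t ht).comp hq).inv₀ (Real.rpow_pos_of_pos ht _).ne'
    refine this.congr fun n => ?_
    simp
  refine tendsto_order.2 ⟨fun b hb => ?_, fun b hb => ?_⟩
  · have h1 : ∀ᶠ t in 𝓝[<] (1 : ℝ), b < (t ^ (-ξ))⁻¹ ∧ 0 < t ∧ t < 1 :=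
      ((hpow1.eventually (lt_mem_nhds hb)).filter_mono nhdsWithin_le_nhds).and
        (((lt_mem_nhds one_pos).filter_mono nhdsWithin_le_nhds).and self_mem_nhdsWithin)
    obtain ⟨t, hbt, ht0, ht1⟩ := h1.exists
    filter_upwards [(ratio t ht0).eventually (lt_mem_nhds hbt), eventually_gt_atTop 0,
      hq.eventually_gt_atTop 0] with n hn hn0 hqn
    have h3 : n⁻¹ < tail G (t * quantile G (1 - n⁻¹)) :=
      lt_tail_of_lt_quantile (by positivity) (by nlinarith)
    have h4 := tail_pos hG (quantile G (1 - n⁻¹))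
    have h5 := tail_pos hG (t * quantile G (1 - n⁻¹))
    refine hn.trans_le ?_
    rw [div_le_iff₀ h5]
    have h6 : 1 ≤ n * tail G (t * quantile G (1 - n⁻¹)) := by
      rw [inv_lt_iff_one_lt_mul₀ hn0] at h3
      linarith
    nlinarith
  · have h1 : ∀ᶠ t in 𝓝[>] (1 : ℝ), (t ^ (-ξ))⁻¹ < b ∧ 1 < t :=
      ((hpow1.eventually (gt_mem_nhds hb)).filter_mono nhdsWithin_le_nhds).and
        self_mem_nhdsWithin
    obtain ⟨t, hbt, ht1⟩ := h1.exists
    filter_upwards [(ratio t (by linarith)).eventually (gt_mem_nhds hbt), eventually_gt_atTop 0,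
      hq.eventually_gt_atTop 0] with n hn hn0 hqn
    have h3 : tail G (t * quantile G (1 - n⁻¹)) ≤ n⁻¹ :=
      tail_le_of_quantile_lt hn0 (by nlinarith)
    have h4 := tail_pos hG (quantile G (1 - n⁻¹))
    have h5 := tail_pos hG (t * quantile G (1 - n⁻¹))
    refine lt_of_le_of_lt ?_ hn
    rw [le_div_iff₀ h5]
    have h6 : n * tail G (t * quantile G (1 - n⁻¹)) ≤ 1 := by
      calc _ ≤ n * n⁻¹ := by gcongr
        _ = 1 := mul_inv_cancel₀ hn0.ne'
    nlinarith

lemma tendsto_pow_mul_tail_mul_quantile {ξ : ℝ} (hG : IsRegularlyVarying (tail G) (-ξ)) {d : ℕ}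
    (hd : 0 < d) {c : ℝ} (hc : 0 < c) :
    Tendsto (fun R : ℝ => R ^ d * tail G (c * quantile G (1 - (R ^ d)⁻¹))) atTop
      (𝓝 (c ^ (-ξ))) := by
  have hR : Tendsto (fun R : ℝ => R ^ d) atTop atTop := tendsto_pow_atTop hd.ne'
  have h1 := (tendsto_mul_tail_quantile hG).comp hR
  have h2 := (hG.tendsto_ratio c hc).comp ((tendsto_quantile_atTop hG).comp hR)
  have h3 := h1.mul h2
  rw [one_mul] at h3
  refine h3.congr fun R => ?_
  have := (tail_pos hG (quantile G (1 - (R ^ d)⁻¹))).ne'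
  simp only [Function.comp]
  rw [mul_assoc, mul_div_cancel₀ _ this]

end RegularVariation

/-! ### Void probabilities -/

section Poisson

variable {Ω X : Type*} [MeasurableSpace Ω] [TopologicalSpace X] [MeasurableSpace X]
  {Φ : Ω → Set X} {ν : Measure X} {P : Measure Ω}

lemma IsPoissonPointProcess.measurableSet_void (hΦ : IsPoissonPointProcess Φ ν P) {A : Set X}
    (hA : MeasurableSet A) : MeasurableSet {ω | Φ ω ∩ A = ∅} := by
  have := hΦ.measurable_count A hA (measurableSet_singleton 0)
  simpa [Set.preimage] using this

/-- The void probabilities of a Poisson point process. -/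
lemma IsPoissonPointProcess.void_probability (hΦ : IsPoissonPointProcess Φ ν P) {A : Set X}
    (hA : MeasurableSet A) (hν : ν A ≠ ∞) :
    P.real {ω | Φ ω ∩ A = ∅} = Real.exp (-(ν A).toReal) := by
  have h1 := congrArg (fun μ : Measure ℕ∞ => μ.real {0}) (hΦ.count_law A hA hν)
  rw [map_measureReal_apply (hΦ.measurable_count A hA) (measurableSet_singleton 0),
    map_measureReal_apply .of_discrete (measurableSet_singleton 0)] at h1
  have h2 : (fun k : ℕ => (k : ℕ∞)) ⁻¹' {0} = {0} := by ext; simp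
  have h3 : (fun ω => (Φ ω ∩ A).encard) ⁻¹' {0} = {ω | Φ ω ∩ A = ∅} := by ext; simp
  rw [h2, h3, poissonMeasure_real_singleton] at h1
  rw [h1, ← ENNReal.coe_toNNReal_eq_toReal]
  simp

lemma IsPoissonPointProcess.ae_void [IsProbabilityMeasure P] (hΦ : IsPoissonPointProcess Φ ν P)
    {A : Set X} (hA : MeasurableSet A) (hν : ν A = 0) : ∀ᵐ ω ∂P, Φ ω ∩ A = ∅ := by
  have h1 := hΦ.void_probability hA (by simp [hν])
  rw [hν] at h1
  simp only [ENNReal.toReal_zero, neg_zero, Real.exp_zero] at h1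
  have h2 : P {ω | Φ ω ∩ A = ∅} = 1 := by
    rw [← ofReal_measureReal (μ := P), h1, ENNReal.ofReal_one]
  exact (prob_compl_eq_zero_iff (hΦ.measurableSet_void hA)).2 h2

end Poisson

/-! ### Suprema of translates over balls -/

section BallSup

variable {E : Type*} [NormedAddCommGroup E]

/-- The supremum of a translate of `h` over an open ball. -/
noncomputable def ballSup (h : E → ℝ≥0∞) (R : ℝ) (x : E) : ℝ≥0∞ :=
  ⨆ y ∈ Metric.ball (0 : E) R, h (y - x)

/-- The supremum of a translate of `h` over a closed ball. -/
noncomputable def closedBallSup (h : E → ℝ≥0∞) (R : ℝ) (x : E) : ℝ≥0∞ :=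
  ⨆ y ∈ Metric.closedBall (0 : E) R, h (y - x)

variable [MeasurableSpace E] [BorelSpace E]

/-- Strict superlevel sets are unions of translates of an open ball, hence open, whatever `h` is. -/
lemma measurable_ballSup (h : E → ℝ≥0∞) (R : ℝ) : Measurable (ballSup h R) := by
  refine measurable_of_Ioi fun t => IsOpen.measurableSet ?_
  have : ballSup h R ⁻¹' Set.Ioi t =
      ⋃ z ∈ {z | t < h z}, (fun x : E => z + x) ⁻¹' Metric.ball 0 R := by
    ext x
    simp only [ballSup, Set.mem_preimage, Set.mem_Ioi, lt_iSup_iff, Set.mem_iUnion,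
      Set.mem_ofPred_eq, exists_prop]
    constructor
    · rintro ⟨y, hy, hlt⟩
      exact ⟨y - x, hlt, by simpa using hy⟩
    · rintro ⟨z, hz, hlt⟩
      exact ⟨z + x, hlt, by simpa using hz⟩
  rw [this]
  exact isOpen_biUnion fun z _ => Metric.isOpen_ball.preimage (by fun_prop)

end BallSup

/-! ### Null level sets of distances; closed versus open balls -/

section DistanceLevelSets

variable {E : Type*} [NormedAddCommGroup E] [NormedSpace ℝ E] [FiniteDimensional ℝ E]
  [MeasurableSpace E] [BorelSpace E] (μ : Measure E) [μ.IsAddHaarMeasure]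

/-- Positive level sets of a distance function are Lebesgue null. -/
lemma addHaar_infDist_eq (A : Set E) {R : ℝ} (hR : 0 < R) :
    μ {x | Metric.infDist x A = R} = 0 := by
  set S := {x | Metric.infDist x A = R} with hS
  have hSm : MeasurableSet S :=
    (isClosed_eq (Metric.continuous_infDist_pt A) continuous_const).measurableSet
  set n := Module.finrank ℝ E
  -- By Lebesgue density almost every point of `S` has density one, so it is enough that no point of
  -- `S` does.
  have hcontra : ∀ x ∈ S, ¬ Tendsto (fun r => μ (S ∩ Metric.closedBall x r) /
      μ (Metric.closedBall x r)) (𝓝[>] 0) (𝓝 1) := by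
    intro x hx hlim
    have hx' : Metric.infDist x A = R := hx
    -- `Metric.infDist` to the empty set is `0`, which `0 < R` rules out.
    have hA : A.Nonempty := by
      by_contra hne
      rw [Set.not_nonempty_iff_eq_empty.1 hne, Metric.infDist_empty] at hx'
      exact hR.ne hx'
    obtain ⟨a, ha, hxa⟩ := isClosed_closure.exists_infDist_eq_dist hA.closure x
    rw [Metric.infDist_closure, hx'] at hxa
    have hbound : ∀ r : ℝ, 0 < r → r < R → μ (S ∩ Metric.closedBall x r) /
        μ (Metric.closedBall x r) ≤ 1 - ENNReal.ofReal ((1 / 2) ^ n) := by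
      intro r hr hrR
      -- Move from `x` by `r / 2` towards a nearest point `a` of the closure: the ball of radius `r
      -- / 2` around `z` stays in the ball around `x`, but all its points are closer than `R` to
      -- `A`. It takes up the proportion `2 ^ (-n)`.
      set z := x + (r / (2 * R)) • (a - x) with hz
      have hnorm : ‖a - x‖ = R := by rw [← dist_eq_norm, dist_comm, ← hxa]
      have hzx : dist z x = r / 2 := by
        rw [hz, dist_eq_norm, add_sub_cancel_left, norm_smul, hnorm, Real.norm_of_nonneg
          (by positivity)]
        field_simp
      have hza : dist z a = R - r / 2 := by
        have : z - a = -((1 - r / (2 * R)) • (a - x)) := by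
          rw [hz, sub_smul, one_smul]; abel
        have hle : r / (2 * R) ≤ 1 := by
          rw [div_le_one (by positivity)]; linarith
        rw [dist_eq_norm, this, norm_neg, norm_smul, hnorm, Real.norm_of_nonneg (by linarith)]
        field_simp
      have hsub : Metric.ball z (r / 2) ⊆ Metric.closedBall x r \ S := by
        intro w hw
        rw [Metric.mem_ball] at hw
        refine ⟨?_, fun hwS => ?_⟩
        · rw [Metric.mem_closedBall]
          linarith [dist_triangle w z x]
        · have h1 : Metric.infDist w A ≤ dist w a := by
            rw [← Metric.infDist_closure]; exact Metric.infDist_le_dist_of_mem ha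
          have h2 : Metric.infDist w A = R := hwS
          linarith [dist_triangle w z a]
      have hcb : μ (Metric.closedBall x r) ≠ 0 :=
        (Metric.measure_closedBall_pos μ x hr).ne'
      have hcb' : μ (Metric.closedBall x r) ≠ ∞ := measure_closedBall_lt_top.ne
      have hball : μ (Metric.ball z (r / 2)) =
          ENNReal.ofReal ((1 / 2) ^ n) * μ (Metric.closedBall x r) := by
        rw [Measure.addHaar_ball_of_pos μ z (by positivity), Measure.addHaar_closedBall μ x hr.le,
          ← mul_assoc, ← ENNReal.ofReal_mul (by positivity), ← mul_pow]
        congr 3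
        ring
      rw [ENNReal.div_le_iff hcb hcb', ENNReal.sub_mul (fun _ _ => hcb'), one_mul, ← hball]
      have hdiff : S ∩ Metric.closedBall x r ⊆ Metric.closedBall x r \ Metric.ball z (r / 2) :=
        fun w hw => ⟨hw.2, fun hw' => (hsub hw').2 hw.1⟩
      refine (measure_mono hdiff).trans_eq ?_
      exact measure_sdiff (hsub.trans Set.sdiff_subset) measurableSet_ball.nullMeasurableSet
        measure_ball_lt_top.ne
    have h1 : (1 : ℝ≥0∞) ≤ 1 - ENNReal.ofReal ((1 / 2) ^ n) := by
      refine le_of_tendsto hlim ?_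
      filter_upwards [Ioo_mem_nhdsGT hR] with r hr using hbound r hr.1 hr.2
    exact absurd h1 (not_le.2 (ENNReal.sub_lt_self (by simp) (by simp) (by simp)))
  have hae := Besicovitch.ae_tendsto_measure_inter_div μ S
  have hfalse : ∀ᵐ x ∂(μ.restrict S), False := by
    filter_upwards [hae, ae_restrict_mem hSm] with x hx hxS using hcontra x hxS hx
  rw [ae_iff] at hfalse
  simpa using hfalse

/-- If a rational `q` separates the two suprema at `x`, then the reflected set `-{h > q}` meets the
closed `R`-ball around `x` but not the open one, so `x` is at distance exactly `R` from it. Such `x`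
form a null set for each of countably many `q`. -/
lemma closedBallSup_ae_eq_ballSup (h : E → ℝ≥0∞) {R : ℝ} (hR : 0 < R) :
    closedBallSup h R =ᵐ[μ] ballSup h R := by
  have hnull : ∀ᵐ x ∂μ, ∀ q : ℚ,
      Metric.infDist x ((fun z => -z) '' {z | ENNReal.ofReal q < h z}) ≠ R := by
    rw [ae_all_iff]
    intro q
    rw [ae_iff]
    simpa using addHaar_infDist_eq μ _ hR
  filter_upwards [hnull] with x hx
  refine le_antisymm ?_ (biSup_mono fun y hy => Metric.ball_subset_closedBall hy)
  by_contra! hlt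
  obtain ⟨q, hq0, hq1, hq2⟩ := ENNReal.lt_iff_exists_rat_btwn.1 hlt
  rw [closedBallSup] at hq2
  simp only [lt_iSup_iff] at hq2
  obtain ⟨y, hy, hqy⟩ := hq2
  set A := (fun z => -z) '' {z | ENNReal.ofReal q < h z}
  have hmem : x - y ∈ A := ⟨y - x, hqy, by simp⟩
  have hle : Metric.infDist x A ≤ R := by
    refine (Metric.infDist_le_dist_of_mem hmem).trans ?_
    simpa [dist_eq_norm] using hy
  refine hx q (hle.antisymm ?_)
  by_contra! hlt'
  obtain ⟨w, ⟨z, hz, rfl⟩, hdist⟩ := (Metric.infDist_lt_iff ⟨_, hmem⟩).1 hlt'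
  have hzx : z + x ∈ Metric.ball (0 : E) R := by
    simpa [dist_eq_norm, add_comm] using hdist
  have : h z ≤ ballSup h R x := by
    have := le_biSup (fun y => h (y - x)) hzx
    simpa [ballSup] using this
  exact absurd (hq1.trans hz) (not_lt.2 this)

lemma exists_measurable_ae_eq_closedBallSup {h : E → ℝ≥0∞} (hmeas : Measurable h) (R : ℝ) :
    ∃ U : E → ℝ≥0∞, Measurable U ∧ closedBallSup h R =ᵐ[μ] U := by
  rcases lt_trichotomy R 0 with hR | rfl | hR
  · refine ⟨fun _ => 0, measurable_const, Eventually.of_forall fun x => ?_⟩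
    simp [closedBallSup, Metric.closedBall_eq_empty.2 hR]
  -- The degenerate ball `{0}` is the only case that needs `h` to be measurable.
  · refine ⟨fun x => h (0 - x), by fun_prop, Eventually.of_forall fun x => ?_⟩
    simp [closedBallSup]
  · exact ⟨_, measurable_ballSup h R, closedBallSup_ae_eq_ballSup μ h hR⟩

end DistanceLevelSets

/-! ### The supremum over a marked Poisson process and its law -/

section MarkedSup

variable {E : Type*}

/-- The supremum of `m * U x` over the marked points `(x, m)` of `S`. -/
noncomputable def markedSup (U : E → ℝ≥0∞) (S : Set (E × Set.Ioi (0 : ℝ))) : ℝ≥0∞ :=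
  ⨆ φ ∈ S, ENNReal.ofReal (φ.2 : ℝ) * U φ.1

/-- The marked points contributing more than `t` to `markedSup U`. -/
def exceedance (U : E → ℝ≥0∞) (t : ℝ≥0∞) : Set (E × Set.Ioi (0 : ℝ)) :=
  {φ | t < ENNReal.ofReal (φ.2 : ℝ) * U φ.1}

lemma markedSup_le_iff (U : E → ℝ≥0∞) (S : Set (E × Set.Ioi (0 : ℝ))) (t : ℝ≥0∞) :
    markedSup U S ≤ t ↔ S ∩ exceedance U t = ∅ := by
  simp only [markedSup, iSup_le_iff, Set.eq_empty_iff_forall_notMem, exceedance, Set.mem_inter_iff,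
    Set.mem_ofPred_eq, not_and, not_lt]

lemma iSup_extremalShotNoise {d : ℕ} (h : EuclideanSpace ℝ (Fin d) → ℝ≥0∞)
    (S : Set (EuclideanSpace ℝ (Fin d) × Set.Ioi (0 : ℝ))) (R : ℝ) :
    (⨆ y ∈ Metric.closedBall (0 : EuclideanSpace ℝ (Fin d)) R, extremalShotNoise h S y) =
      markedSup (closedBallSup h R) S := by
  simp only [extremalShotNoise, markedSup, closedBallSup, ENNReal.mul_iSup]
  exact iSup₂_comm _

variable [MeasurableSpace E]

lemma measurableSet_exceedance {U : E → ℝ≥0∞} (hU : Measurable U) (t : ℝ≥0∞) :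
    MeasurableSet (exceedance U t) := by
  refine measurableSet_lt measurable_const (Measurable.mul ?_ (hU.comp measurable_fst))
  exact (measurable_subtype_coe.comp measurable_snd).ennreal_ofReal

variable {Ω : Type*} [MeasurableSpace Ω] [TopologicalSpace E]
  {Φ : Ω → Set (E × Set.Ioi (0 : ℝ))} {P : Measure Ω} {ν : Measure (E × Set.Ioi (0 : ℝ))}

lemma measurable_markedSup (hΦ : IsPoissonPointProcess Φ ν P) {U : E → ℝ≥0∞} (hU : Measurable U) :
    Measurable fun ω => markedSup U (Φ ω) := by
  refine measurable_of_Iic fun t => ?_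
  simp only [Set.preimage, Set.mem_Iic, markedSup_le_iff]
  exact hΦ.measurableSet_void (measurableSet_exceedance hU t)

lemma markedSup_law (hΦ : IsPoissonPointProcess Φ ν P) {U : E → ℝ≥0∞} (hU : Measurable U)
    (t : ℝ≥0∞) (hν : ν (exceedance U t) ≠ ∞) :
    P.real {ω | markedSup U (Φ ω) ≤ t} = Real.exp (-(ν (exceedance U t)).toReal) := by
  simp only [markedSup_le_iff]
  exact hΦ.void_probability (measurableSet_exceedance hU t) hν

/-- The set of marked points over a null set of locations has zero intensity, so almost surely no
point sees the difference between `U` and `V`. -/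
lemma markedSup_ae_congr [IsProbabilityMeasure P] {μ : Measure E} {ρ : Measure (Set.Ioi (0 : ℝ))}
    [SFinite ρ] (hΦ : IsPoissonPointProcess Φ (μ.prod ρ) P) {U V : E → ℝ≥0∞} (hUV : U =ᵐ[μ] V) :
    (fun ω => markedSup U (Φ ω)) =ᵐ[P] fun ω => markedSup V (Φ ω) := by
  obtain ⟨N, hN, hNm, hN0⟩ := exists_measurable_superset_of_null (ae_iff.1 hUV)
  have h0 : (μ.prod ρ) (N ×ˢ Set.univ) = 0 := by simp [hN0]
  filter_upwards [hΦ.ae_void (hNm.prod .univ) h0] with ω hω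
  refine biSup_congr fun φ hφ => ?_
  have : φ.1 ∉ N := fun hmem => by
    have : φ ∈ Φ ω ∩ N ×ˢ Set.univ := ⟨hφ, hmem, trivial⟩
    rw [hω] at this
    exact this
  have h2 : U φ.1 = V φ.1 := by
    by_contra hne
    exact this (hN hne)
  rw [h2]

lemma ae_markedSup_lt_top [IsProbabilityMeasure P] (hΦ : IsPoissonPointProcess Φ ν P)
    {U : E → ℝ≥0∞} (hU : Measurable U) {t : ℕ → ℝ≥0∞} (ht : ∀ k, t k ≠ ∞)
    (hlim : Tendsto (fun k => ν (exceedance U (t k))) atTop (𝓝 0)) :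
    ∀ᵐ ω ∂P, markedSup U (Φ ω) < ∞ := by
  have hm : MeasurableSet {ω | markedSup U (Φ ω) < ∞} :=
    measurable_markedSup hΦ hU measurableSet_Iio
  have h1 : Tendsto (fun k => Real.exp (-(ν (exceedance U (t k))).toReal)) atTop (𝓝 1) := by
    have := ((ENNReal.tendsto_toReal ENNReal.zero_ne_top).comp hlim).neg.rexp
    simpa using this
  have h2 : 1 ≤ P.real {ω | markedSup U (Φ ω) < ∞} := by
    refine le_of_tendsto h1 ?_
    filter_upwards [hlim.eventually (gt_mem_nhds one_pos)] with k hk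
    rw [← markedSup_law hΦ hU (t k) (hk.trans ENNReal.one_lt_top).ne]
    exact measureReal_mono fun ω hω => lt_of_le_of_lt hω (ht k).lt_top
  have h3 : P {ω | markedSup U (Φ ω) < ∞} = 1 := by
    rw [← ofReal_measureReal (μ := P), h2.antisymm' measureReal_le_one, ENNReal.ofReal_one]
  exact (prob_compl_eq_zero_iff hm).2 h3

end MarkedSup

/-! ### Consequences of the decay of the shape function -/

section Decay

variable {d : ℕ} {h : EuclideanSpace ℝ (Fin d) → ℝ≥0∞} {γ C : ℝ}

lemma decay_le_const (hC : ∀ x, h x ≤ ENNReal.ofReal C * min (‖x‖ₑ ^ (-γ)) 1)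
    (x : EuclideanSpace ℝ (Fin d)) : h x ≤ ENNReal.ofReal C :=
  (hC x).trans (mul_le_of_le_one_right' (min_le_right _ _))

lemma decay_le_rpow (hγ : 0 < γ) (hC0 : 0 ≤ C)
    (hC : ∀ x, h x ≤ ENNReal.ofReal C * min (‖x‖ₑ ^ (-γ)) 1)
    {x : EuclideanSpace ℝ (Fin d)} {ρ : ℝ} (hρ : 0 < ρ) (hx : ρ ≤ ‖x‖) :
    h x ≤ ENNReal.ofReal (C * ρ ^ (-γ)) := by
  refine (hC x).trans ?_
  rw [ENNReal.ofReal_mul hC0, ← ENNReal.ofReal_rpow_of_pos hρ]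
  gcongr
  refine (min_le_left _ _).trans ?_
  rw [ENNReal.rpow_neg, ENNReal.rpow_neg, ENNReal.inv_le_inv]
  refine ENNReal.rpow_le_rpow ?_ hγ.le
  rw [← ofReal_norm]
  exact ENNReal.ofReal_le_ofReal hx

lemma ballSup_le {R : ℝ} {b : ℝ≥0∞} (hb : ∀ x, h x ≤ b) (x : EuclideanSpace ℝ (Fin d)) :
    ballSup h R x ≤ b := iSup₂_le fun _ _ => hb _

lemma ballSup_le_rpow (hγ : 0 < γ) (hC0 : 0 ≤ C)
    (hC : ∀ x, h x ≤ ENNReal.ofReal C * min (‖x‖ₑ ^ (-γ)) 1) {R ρ : ℝ}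
    {x : EuclideanSpace ℝ (Fin d)} (hρ : 0 < ρ) (hx : ρ + R ≤ ‖x‖) :
    ballSup h R x ≤ ENNReal.ofReal (C * ρ ^ (-γ)) := by
  refine iSup₂_le fun y hy => decay_le_rpow hγ hC0 hC hρ ?_
  have h1 : ‖y‖ < R := by simpa using hy
  have h2 := norm_sub_norm_le x y
  rw [norm_sub_rev] at h2
  linarith

lemma le_ballSup {R : ℝ} {x z : EuclideanSpace ℝ (Fin d)} (hx : ‖x‖ < R - ‖z‖) :
    h z ≤ ballSup h R x := by
  have hzx : z + x ∈ Metric.ball (0 : EuclideanSpace ℝ (Fin d)) R := by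
    rw [mem_ball_zero_iff]
    linarith [norm_add_le z x]
  have := le_biSup (fun y => h (y - x)) hzx
  simpa [ballSup] using this

end Decay

/-! ### Bounds for the intensity of exceedances -/

section Intensity

variable {G : Measure (Set.Ioi (0 : ℝ))} [IsProbabilityMeasure G]

lemma measure_mark_le {u t : ℝ} {b : ℝ≥0∞} (hu : 0 < u) (hb : b ≤ ENNReal.ofReal u) :
    G {m | ENNReal.ofReal t < ENNReal.ofReal (m : ℝ) * b} ≤ ENNReal.ofReal (tail G (t / u)) := by
  rw [← measure_lt_eq_ofReal_tail]
  refine measure_mono fun m hm => ?_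
  have hm0 : (0 : ℝ) < m := m.2
  have h1 : ENNReal.ofReal t < ENNReal.ofReal ((m : ℝ) * u) := by
    rw [ENNReal.ofReal_mul hm0.le]
    exact lt_of_lt_of_le hm (by gcongr)
  change t / u < m
  rw [div_lt_iff₀ hu]
  exact (ENNReal.ofReal_lt_ofReal_iff (by positivity)).1 h1

variable {d : ℕ} {h : EuclideanSpace ℝ (Fin d) → ℝ≥0∞} {ξ lam : ℝ}

/-- Lower bound for the intensity of the points exceeding the level `K * q`. -/
lemma le_intensity_exceedance (hlam : 0 < lam) {K q θ R : ℝ} (hK : 0 < K)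
    (hθ : 0 < θ) {z : EuclideanSpace ℝ (Fin d)} (hz : ENNReal.ofReal (K * θ) ≤ h z)
    (hR : ‖z‖ < R) :
    ENNReal.ofReal (lam * tail G (q / θ) *
      (volume.real (Metric.ball (0 : EuclideanSpace ℝ (Fin d)) 1) * (R - ‖z‖) ^ d)) ≤
    ((volume : Measure (EuclideanSpace ℝ (Fin d))).prod (ENNReal.ofReal lam • G))
      (exceedance (ballSup h R) (ENNReal.ofReal (K * q))) := by
  have hsub : Metric.ball (0 : EuclideanSpace ℝ (Fin d)) (R - ‖z‖) ×ˢ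
      {m : Set.Ioi (0 : ℝ) | q / θ < (m : ℝ)} ⊆
      exceedance (ballSup h R) (ENNReal.ofReal (K * q)) := by
    rintro ⟨x, m⟩ ⟨hx, hm⟩
    have hx' : ‖x‖ < R - ‖z‖ := by simpa using hx
    have hm0 : (0 : ℝ) < m := m.2
    have hm' : q < m * θ := (div_lt_iff₀ hθ).1 hm
    have h1 : ENNReal.ofReal (K * q) < ENNReal.ofReal ((m : ℝ) * (K * θ)) := by
      rw [ENNReal.ofReal_lt_ofReal_iff (by positivity)]
      nlinarith
    rw [ENNReal.ofReal_mul hm0.le] at h1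
    refine lt_of_lt_of_le h1 ?_
    change _ ≤ ENNReal.ofReal (m : ℝ) * ballSup h R x
    gcongr
    exact hz.trans (le_ballSup hx')
  refine le_trans (le_of_eq ?_) (measure_mono hsub)
  rw [Measure.prod_prod, Measure.smul_apply, measure_lt_eq_ofReal_tail, smul_eq_mul,
    Measure.addHaar_ball_of_pos _ _ (by linarith), finrank_euclideanSpace_fin,
    ENNReal.ofReal_mul (mul_nonneg hlam.le (tail_nonneg _)), ENNReal.ofReal_mul hlam.le,
    ENNReal.ofReal_mul measureReal_nonneg, ofReal_measureReal]
  ring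

/-- Upper bound for the intensity of the points exceeding the level `K * q`. -/
lemma exists_intensity_exceedance_le (hξ : 0 < ξ) (hlam : 0 < lam)
    (hG : IsRegularlyVarying (tail G) (-ξ)) (hdecay : DecayCondition ξ h) {K : ℝ} (hK : 0 < K)
    (hhK : ∀ x, h x ≤ ENNReal.ofReal K) {δ : ℝ} (hδ : 0 < δ) :
    ∃ J R₀ q₀ : ℝ, 0 ≤ J ∧ 0 < R₀ ∧ 0 < q₀ ∧ ∀ R q, R₀ ≤ R → q₀ ≤ q →
      ((volume : Measure (EuclideanSpace ℝ (Fin d))).prod (ENNReal.ofReal lam • G))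
        (exceedance (ballSup h R) (ENNReal.ofReal (K * q))) ≤
      ENNReal.ofReal (lam * tail G q *
        (volume.real (Metric.ball (0 : EuclideanSpace ℝ (Fin d)) 1) * ((1 + δ) * R) ^ d + J)) := by
  obtain ⟨γ, C, hγ, hC0, hC⟩ := hdecay
  have hγ0 : 0 < γ := lt_of_le_of_lt (by positivity) hγ
  have hdγ : (d : ℝ) / γ < ξ := by
    rw [div_lt_iff₀ hξ] at hγ
    rw [div_lt_iff₀ hγ0]
    linarith
  -- `η < ξ` allows the Potter bound, while `γ * η > d` makes `(1 + ‖x‖) ^ (-(γ * η))` integrable.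
  -- Such an `η` exists precisely because `γ > d / ξ`.
  obtain ⟨η, hη1, hηξ⟩ := exists_between hdγ
  have hη0 : 0 < η := lt_of_le_of_lt (by positivity) hη1
  have hdη : (d : ℝ) < γ * η := by
    rw [div_lt_iff₀ hγ0] at hη1
    linarith
  obtain ⟨q₀, hq₀, hpot⟩ := hG.exists_potter_bound tail_antitone hη0 hηξ
  -- Outside radius `(1 + δ) R` the distance to the ball is at least `δ / (1 + δ) * ‖x‖`; the extra
  -- `2` absorbs `1 + ‖x‖ ≤ 2 ‖x‖`. There a mark must exceed `b * (1 + ‖x‖) ^ γ * q`, and `c` is the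
  -- resulting Potter constant.
  set κ : ℝ := δ / (2 * (1 + δ)) with hκ
  have hκ0 : 0 < κ := by positivity
  set b : ℝ := K / C * κ ^ γ with hb
  have hb0 : 0 < b := by positivity
  set c : ℝ := 2 ^ η * b ^ (-η) with hc
  have hc0 : 0 < c := by positivity
  have hJfin : ∫⁻ x : EuclideanSpace ℝ (Fin d), ENNReal.ofReal ((1 + ‖x‖) ^ (-(γ * η))) < ∞ :=
    finite_integral_one_add_norm (by simpa using hdη)
  set I := ∫⁻ x : EuclideanSpace ℝ (Fin d), ENNReal.ofReal ((1 + ‖x‖) ^ (-(γ * η))) with hI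
  -- The Potter bound needs a multiplier of at least `1`.
  have hlarge : ∀ᶠ R : ℝ in atTop, 1 ≤ b * R ^ γ :=
    ((tendsto_rpow_atTop hγ0).const_mul_atTop hb0).eventually_ge_atTop 1
  obtain ⟨R₁, hR₁⟩ := eventually_atTop.1 hlarge
  refine ⟨c * I.toReal, max R₁ 1, q₀, by positivity, by positivity, hq₀, fun R q hR hq => ?_⟩
  have hR1 : 1 ≤ R := (le_max_right _ _).trans hR
  have hRR : R₁ ≤ R := (le_max_left _ _).trans hR
  have hq0 : 0 < q := hq₀.trans_le hq
  have hpoint : ∀ x : EuclideanSpace ℝ (Fin d),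
      G {m | ENNReal.ofReal (K * q) < ENNReal.ofReal (m : ℝ) * ballSup h R x} ≤
      ENNReal.ofReal (tail G q) *
        ((Metric.closedBall (0 : EuclideanSpace ℝ (Fin d)) ((1 + δ) * R)).indicator 1 x +
          ENNReal.ofReal c * ENNReal.ofReal ((1 + ‖x‖) ^ (-(γ * η)))) := by
    intro x
    by_cases hx : x ∈ Metric.closedBall (0 : EuclideanSpace ℝ (Fin d)) ((1 + δ) * R)
    · rw [Set.indicator_of_mem hx]
      refine (measure_mark_le hK (ballSup_le hhK x)).trans ?_
      rw [mul_div_cancel_left₀ _ hK.ne']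
      exact le_mul_of_one_le_right' (le_add_right le_rfl)
    · rw [Set.indicator_of_notMem hx, zero_add]
      rw [mem_closedBall_zero_iff, not_le] at hx
      have hxR : R ≤ ‖x‖ := by nlinarith
      have hρ : κ * (1 + ‖x‖) + R ≤ ‖x‖ := by
        have h1 : κ * (1 + ‖x‖) ≤ δ / (1 + δ) * ‖x‖ := by
          rw [hκ, div_mul_eq_mul_div, div_mul_eq_mul_div, div_le_div_iff₀ (by positivity)
            (by positivity)]
          nlinarith [mul_pos hδ (by linarith : 0 < 1 + δ)]
        have h2 : R ≤ ‖x‖ - δ / (1 + δ) * ‖x‖ := by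
          have : ‖x‖ - δ / (1 + δ) * ‖x‖ = ‖x‖ / (1 + δ) := by field_simp; ring
          rw [this, le_div_iff₀ (by positivity)]
          linarith
        linarith
      have hpos : 0 < κ * (1 + ‖x‖) := by positivity
      refine (measure_mark_le (by positivity) (ballSup_le_rpow hγ0 hC0.le hC hpos hρ)).trans ?_
      have heq : K * q / (C * (κ * (1 + ‖x‖)) ^ (-γ)) = (b * (1 + ‖x‖) ^ γ) * q := by
        rw [hb, Real.mul_rpow hκ0.le (by positivity), Real.rpow_neg hκ0.le,
          Real.rpow_neg (by positivity)]
        field_simp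
      have hv : 1 ≤ b * (1 + ‖x‖) ^ γ := hR₁ _ (by linarith)
      rw [heq, ← ENNReal.ofReal_mul hc0.le, ← ENNReal.ofReal_mul (tail_nonneg _)]
      refine ENNReal.ofReal_le_ofReal ((hpot q hq _ hv).trans_eq ?_)
      rw [Real.mul_rpow hb0.le (by positivity), ← Real.rpow_mul (by positivity), hc,
        mul_neg]
      ring
  rw [Measure.prod_apply (measurableSet_exceedance (measurable_ballSup h R) _)]
  calc ∫⁻ x, (ENNReal.ofReal lam • G)
        (Prod.mk x ⁻¹' exceedance (ballSup h R) (ENNReal.ofReal (K * q)))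
      ≤ ∫⁻ x, ENNReal.ofReal (lam * tail G q) *
        ((Metric.closedBall (0 : EuclideanSpace ℝ (Fin d)) ((1 + δ) * R)).indicator 1 x +
          ENNReal.ofReal c * ENNReal.ofReal ((1 + ‖x‖) ^ (-(γ * η)))) := by
        refine lintegral_mono fun x => ?_
        rw [Measure.smul_apply, smul_eq_mul, ENNReal.ofReal_mul hlam.le, mul_assoc]
        gcongr
        exact hpoint x
    _ = ENNReal.ofReal (lam * tail G q) *
        (volume (Metric.closedBall (0 : EuclideanSpace ℝ (Fin d)) ((1 + δ) * R)) +
          ENNReal.ofReal c * I) := by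
        rw [lintegral_const_mul' _ _ ENNReal.ofReal_ne_top, lintegral_add_left
          (measurable_one.indicator measurableSet_closedBall),
          lintegral_indicator_one measurableSet_closedBall,
          lintegral_const_mul' _ _ ENNReal.ofReal_ne_top]
    _ = _ := by
        rw [Measure.addHaar_closedBall _ _ (by positivity), finrank_euclideanSpace_fin,
          ENNReal.ofReal_mul (mul_nonneg hlam.le (tail_nonneg _)),
          ENNReal.ofReal_add (by positivity) (by positivity),
          ENNReal.ofReal_mul measureReal_nonneg, ofReal_measureReal,
          ENNReal.ofReal_mul hc0.le, ENNReal.ofReal_toReal hJfin.ne]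
        congr 2
        ring

end Intensity

/-! ### Limit of the intensity and of the distribution functions -/

section Limit

variable {G : Measure (Set.Ioi (0 : ℝ))} {d : ℕ} {h : EuclideanSpace ℝ (Fin d) → ℝ≥0∞} {ξ lam : ℝ}

lemma normalisation_mul_eq (s R : ℝ) :
    normalisation h G lam ξ R * s = (⨆ x, h x).toReal *
      ((volume.real (Metric.ball (0 : EuclideanSpace ℝ (Fin d)) 1)) ^ (1 / ξ) * lam ^ (1 / ξ) * s *
        quantile G (1 - (R ^ d)⁻¹)) := by
  rw [normalisation]
  ring

variable [IsProbabilityMeasure G]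

lemma volume_real_unitBall_pos (d : ℕ) :
    0 < volume.real (Metric.ball (0 : EuclideanSpace ℝ (Fin d)) 1) :=
  ENNReal.toReal_pos (Metric.measure_ball_pos _ _ one_pos).ne' measure_ball_lt_top.ne

lemma iSup_ne_top_of_decay (hdecay : DecayCondition ξ h) : (⨆ x, h x) ≠ ∞ := by
  obtain ⟨γ, C, -, -, hC⟩ := hdecay
  exact ((iSup_le (decay_le_const hC)).trans_lt ENNReal.ofReal_lt_top).ne

lemma iSup_toReal_pos (hne : ∃ x, h x ≠ 0) (hdecay : DecayCondition ξ h) :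
    0 < (⨆ x, h x).toReal := by
  obtain ⟨x, hx⟩ := hne
  refine ENNReal.toReal_pos (fun h0 => hx ?_) (iSup_ne_top_of_decay hdecay)
  exact le_antisymm ((le_iSup h x).trans_eq h0) zero_le

/-- This identity dictates the constants in the normalisation: raised to the power `-ξ` they cancel
the factor `λ c_d` of the intensity. -/
lemma normalising_const_rpow (hξ : 0 < ξ) (hlam : 0 < lam) {v s : ℝ} (hv : 0 < v) (hs : 0 < s) :
    lam * (v * (v ^ (1 / ξ) * lam ^ (1 / ξ) * s) ^ (-ξ)) = s ^ (-ξ) := by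
  have key : ∀ y : ℝ, 0 < y → (y ^ (1 / ξ)) ^ (-ξ) = y⁻¹ := fun y hy => by
    rw [← Real.rpow_mul hy.le, ← Real.rpow_neg_one]
    congr 1
    field_simp
  rw [Real.mul_rpow (by positivity) hs.le, Real.mul_rpow (by positivity) (by positivity),
    key v hv, key lam hlam]
  field_simp

lemma tendsto_quantile_pow (hd : 0 < d) (hG : IsRegularlyVarying (tail G) (-ξ)) :
    Tendsto (fun R : ℝ => quantile G (1 - (R ^ d)⁻¹)) atTop atTop :=
  (tendsto_quantile_atTop hG).comp (tendsto_pow_atTop hd.ne')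

lemma eventually_normalisation_pos (hd : 0 < d) (hlam : 0 < lam)
    (hG : IsRegularlyVarying (tail G) (-ξ)) (hne : ∃ x, h x ≠ 0) (hdecay : DecayCondition ξ h) :
    ∀ᶠ R in atTop, 0 < normalisation h G lam ξ R := by
  filter_upwards [(tendsto_quantile_pow hd hG).eventually_gt_atTop 0] with R hR
  have h1 := iSup_toReal_pos hne hdecay
  have h2 := volume_real_unitBall_pos d
  rw [normalisation]
  positivity

lemma eventually_intensity_lt (hd : 0 < d) (hξ : 0 < ξ) (hlam : 0 < lam)
    (hG : IsRegularlyVarying (tail G) (-ξ)) (hne : ∃ x, h x ≠ 0) (hdecay : DecayCondition ξ h)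
    {s : ℝ} (hs : 0 < s) {b : ℝ≥0∞} (hb : ENNReal.ofReal (s ^ (-ξ)) < b) :
    ∀ᶠ R in atTop,
      ((volume : Measure (EuclideanSpace ℝ (Fin d))).prod (ENNReal.ofReal lam • G))
        (exceedance (ballSup h R) (ENNReal.ofReal (normalisation h G lam ξ R * s))) < b := by
  have hK := iSup_toReal_pos hne hdecay
  have hv := volume_real_unitBall_pos d
  set v := volume.real (Metric.ball (0 : EuclideanSpace ℝ (Fin d)) 1) with hvdef
  set c := v ^ (1 / ξ) * lam ^ (1 / ξ) * s with hc
  have hc0 : 0 < c := by positivity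
  have hcont : Tendsto (fun δ : ℝ => ENNReal.ofReal ((1 + δ) ^ d * s ^ (-ξ))) (𝓝[>] 0)
      (𝓝 (ENNReal.ofReal (s ^ (-ξ)))) := by
    have : Continuous fun δ : ℝ => ENNReal.ofReal ((1 + δ) ^ d * s ^ (-ξ)) :=
      ENNReal.continuous_ofReal.comp (by fun_prop)
    simpa using (this.tendsto 0).mono_left nhdsWithin_le_nhds
  -- With this `δ` fixed, the constant `J` drops out of the limit, being multiplied by a vanishing
  -- tail without the factor `R ^ d`.
  obtain ⟨δ, hδb, hδ⟩ := ((hcont.eventually (gt_mem_nhds hb)).and self_mem_nhdsWithin).exists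
  have hhK : ∀ x, h x ≤ ENNReal.ofReal (⨆ x, h x).toReal := fun x => by
    rw [ENNReal.ofReal_toReal (iSup_ne_top_of_decay hdecay)]
    exact le_iSup h x
  obtain ⟨J, R₀, q₀, -, -, -, hbound⟩ :=
    exists_intensity_exceedance_le hξ hlam hG hdecay hK hhK hδ
  have hq : Tendsto (fun R : ℝ => c * quantile G (1 - (R ^ d)⁻¹)) atTop atTop :=
    (tendsto_quantile_pow hd hG).const_mul_atTop hc0
  have hlim : Tendsto (fun R : ℝ => ENNReal.ofReal (lam * tail G (c * quantile G (1 - (R ^ d)⁻¹)) *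
      (v * ((1 + δ) * R) ^ d + J))) atTop (𝓝 (ENNReal.ofReal ((1 + δ) ^ d * s ^ (-ξ)))) := by
    have h1 := (tendsto_pow_mul_tail_mul_quantile hG hd hc0).const_mul (lam * v * (1 + δ) ^ d)
    have h2 := ((tail_tendsto_zero (G := G)).comp hq).const_mul (lam * J)
    have h3 := ENNReal.tendsto_ofReal (h1.add h2)
    have h4 : lam * v * (1 + δ) ^ d * c ^ (-ξ) + lam * J * 0 = (1 + δ) ^ d * s ^ (-ξ) := by
      rw [← normalising_const_rpow hξ hlam hv hs]
      ring
    rw [h4] at h3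
    refine h3.congr fun R => ?_
    congr 1
    simp only [Function.comp, mul_pow]
    ring
  filter_upwards [hlim.eventually (gt_mem_nhds hδb), eventually_ge_atTop R₀,
    hq.eventually_ge_atTop q₀] with R hR hR₀ hqR
  rw [normalisation_mul_eq]
  exact (hbound R _ hR₀ hqR).trans_lt hR

lemma eventually_lt_intensity (hd : 0 < d) (hξ : 0 < ξ) (hlam : 0 < lam)
    (hG : IsRegularlyVarying (tail G) (-ξ)) (hne : ∃ x, h x ≠ 0) (hdecay : DecayCondition ξ h)
    {s : ℝ} (hs : 0 < s) {b : ℝ≥0∞} (hb : b < ENNReal.ofReal (s ^ (-ξ))) :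
    ∀ᶠ R in atTop, b <
      ((volume : Measure (EuclideanSpace ℝ (Fin d))).prod (ENNReal.ofReal lam • G))
        (exceedance (ballSup h R) (ENNReal.ofReal (normalisation h G lam ξ R * s))) := by
  have hK := iSup_toReal_pos hne hdecay
  have hv := volume_real_unitBall_pos d
  set v := volume.real (Metric.ball (0 : EuclideanSpace ℝ (Fin d)) 1) with hvdef
  set c := v ^ (1 / ξ) * lam ^ (1 / ξ) * s with hc
  have hcont : Tendsto (fun θ : ℝ => ENNReal.ofReal ((s / θ) ^ (-ξ))) (𝓝[<] 1)
      (𝓝 (ENNReal.ofReal (s ^ (-ξ)))) := by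
    have h1 : Tendsto (fun θ : ℝ => s / θ) (𝓝[<] 1) (𝓝 s) := by
      have : ContinuousAt (fun θ : ℝ => s / θ) 1 :=
        continuousAt_const.div continuousAt_id one_ne_zero
      have h2 := this.tendsto
      simp only [div_one] at h2
      exact h2.mono_left nhdsWithin_le_nhds
    exact ENNReal.tendsto_ofReal
      ((Real.continuousAt_rpow_const s (-ξ) (Or.inl hs.ne')).tendsto.comp h1)
  obtain ⟨θ, hθb, (hθ1 : θ < 1), hθ0⟩ := ((hcont.eventually (lt_mem_nhds hb)).and
    ((eventually_mem_nhdsWithin (s := Set.Iio (1 : ℝ))).and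
      ((lt_mem_nhds one_pos).filter_mono nhdsWithin_le_nhds))).exists
  -- The supremum of `h` need not be attained, so a value above the fraction `θ < 1` of it is used.
  have hz : ENNReal.ofReal ((⨆ x, h x).toReal * θ) < ⨆ x, h x := by
    rw [← ENNReal.ofReal_toReal (iSup_ne_top_of_decay hdecay), ENNReal.toReal_ofReal hK.le,
      ENNReal.ofReal_lt_ofReal_iff hK]
    nlinarith
  obtain ⟨z, hz⟩ := lt_iSup_iff.1 hz
  have hc0 : 0 < v ^ (1 / ξ) * lam ^ (1 / ξ) * (s / θ) := by positivity
  have hlim : Tendsto (fun R : ℝ => ENNReal.ofReal (lam *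
      tail G (c * quantile G (1 - (R ^ d)⁻¹) / θ) * (v * (R - ‖z‖) ^ d))) atTop
      (𝓝 (ENNReal.ofReal ((s / θ) ^ (-ξ)))) := by
    have h1 := (tendsto_pow_mul_tail_mul_quantile hG hd hc0).const_mul (lam * v)
    have h2 : Tendsto (fun R : ℝ => (1 - ‖z‖ * R⁻¹) ^ d) atTop (𝓝 1) := by
      have := ((tendsto_inv_atTop_zero (𝕜 := ℝ)).const_mul ‖z‖).const_sub 1 |>.pow d
      simpa using this
    have h3 := ENNReal.tendsto_ofReal (h1.mul h2)
    rw [mul_one, mul_assoc lam v, normalising_const_rpow hξ hlam hv (by positivity)] at h3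
    refine h3.congr' ?_
    filter_upwards [eventually_gt_atTop 0] with R hR
    have h4 : (R - ‖z‖) ^ d = R ^ d * (1 - ‖z‖ * R⁻¹) ^ d := by
      rw [← mul_pow]
      congr 1
      field_simp
    have h5 : c * quantile G (1 - (R ^ d)⁻¹) / θ =
        v ^ (1 / ξ) * lam ^ (1 / ξ) * (s / θ) * quantile G (1 - (R ^ d)⁻¹) := by
      rw [hc]; ring
    rw [h4, h5]
    congr 1
    ring
  filter_upwards [hlim.eventually (lt_mem_nhds hθb), eventually_gt_atTop ‖z‖] with R hR hzR
  rw [normalisation_mul_eq]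
  exact hR.trans_le (le_intensity_exceedance hlam hK hθ0 hz.le hzR)

lemma tendsto_intensity (hd : 0 < d) (hξ : 0 < ξ) (hlam : 0 < lam)
    (hG : IsRegularlyVarying (tail G) (-ξ)) (hne : ∃ x, h x ≠ 0) (hdecay : DecayCondition ξ h)
    {s : ℝ} (hs : 0 < s) :
    Tendsto (fun R : ℝ =>
      ((volume : Measure (EuclideanSpace ℝ (Fin d))).prod (ENNReal.ofReal lam • G))
        (exceedance (ballSup h R) (ENNReal.ofReal (normalisation h G lam ξ R * s)))) atTop
      (𝓝 (ENNReal.ofReal (s ^ (-ξ)))) :=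
  tendsto_order.2 ⟨fun _ hb => eventually_lt_intensity hd hξ hlam hG hne hdecay hs hb,
    fun _ hb => eventually_intensity_lt hd hξ hlam hG hne hdecay hs hb⟩

variable {Ω : Type*} [MeasurableSpace Ω] {P : Measure Ω} [IsProbabilityMeasure P]
  {Φ : Ω → Set (EuclideanSpace ℝ (Fin d) × Set.Ioi (0 : ℝ))}

lemma ae_markedSup_closedBallSup_lt_top (hξ : 0 < ξ) (hlam : 0 < lam)
    (hG : IsRegularlyVarying (tail G) (-ξ)) (hne : ∃ x, h x ≠ 0) (hdecay : DecayCondition ξ h)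
    (hΦ : IsPoissonPointProcess Φ
      ((volume : Measure (EuclideanSpace ℝ (Fin d))).prod (ENNReal.ofReal lam • G)) P) (R : ℝ) :
    ∀ᵐ ω ∂P, markedSup (closedBallSup h R) (Φ ω) < ∞ := by
  have hK := iSup_toReal_pos hne hdecay
  have hhK : ∀ x, h x ≤ ENNReal.ofReal (⨆ x, h x).toReal := fun x => by
    rw [ENNReal.ofReal_toReal (iSup_ne_top_of_decay hdecay)]
    exact le_iSup h x
  obtain ⟨J, R₀, q₀, -, hR₀, -, hbound⟩ :=
    exists_intensity_exceedance_le hξ hlam hG hdecay hK hhK one_pos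
  -- Enlarging the ball only increases the supremum, and brings the radius into the range of the
  -- intensity bound.
  have hR' : 0 < max R R₀ := lt_max_of_lt_right hR₀
  have hfin : ∀ᵐ ω ∂P, markedSup (ballSup h (max R R₀)) (Φ ω) < ∞ := by
    refine ae_markedSup_lt_top hΦ (measurable_ballSup h _)
      (t := fun k : ℕ => ENNReal.ofReal ((⨆ x, h x).toReal * k)) (fun _ => ENNReal.ofReal_ne_top) ?_
    have hlim : Tendsto (fun k : ℕ => ENNReal.ofReal (lam * tail G k *
        (volume.real (Metric.ball (0 : EuclideanSpace ℝ (Fin d)) 1) *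
          ((1 + 1) * max R R₀) ^ d + J))) atTop (𝓝 0) := by
      have h1 := ENNReal.tendsto_ofReal ((((tail_tendsto_zero (G := G)).comp
        tendsto_natCast_atTop_atTop).const_mul lam).mul_const
          (volume.real (Metric.ball (0 : EuclideanSpace ℝ (Fin d)) 1) *
            ((1 + 1) * max R R₀) ^ d + J))
      simpa using h1
    refine tendsto_of_tendsto_of_tendsto_of_le_of_le' tendsto_const_nhds hlim
      (Eventually.of_forall fun _ => zero_le) ?_
    filter_upwards [tendsto_natCast_atTop_atTop.eventually_ge_atTop q₀] with k hk
    exact hbound _ _ (le_max_right _ _) hk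
  filter_upwards [hfin, markedSup_ae_congr hΦ
    (closedBallSup_ae_eq_ballSup volume h hR')] with ω h1 h2
  refine lt_of_le_of_lt ?_ (h2.trans_lt h1)
  refine iSup₂_mono fun φ _ => ?_
  gcongr
  exact biSup_mono fun y hy => Metric.closedBall_subset_closedBall (le_max_left _ _) hy

lemma aemeasurable_markedSup_closedBallSup (hmeas : Measurable h)
    (hΦ : IsPoissonPointProcess Φ
      ((volume : Measure (EuclideanSpace ℝ (Fin d))).prod (ENNReal.ofReal lam • G)) P) (R : ℝ) :
    AEMeasurable (fun ω => markedSup (closedBallSup h R) (Φ ω)) P := by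
  obtain ⟨U, hU, hUae⟩ := exists_measurable_ae_eq_closedBallSup volume hmeas R
  exact ⟨_, measurable_markedSup hΦ hU, markedSup_ae_congr hΦ hUae⟩

lemma tendsto_distribution_of_pos (hd : 0 < d) (hξ : 0 < ξ) (hlam : 0 < lam)
    (hG : IsRegularlyVarying (tail G) (-ξ)) (hne : ∃ x, h x ≠ 0) (hdecay : DecayCondition ξ h)
    (hΦ : IsPoissonPointProcess Φ
      ((volume : Measure (EuclideanSpace ℝ (Fin d))).prod (ENNReal.ofReal lam • G)) P)
    {s : ℝ} (hs : 0 < s) :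
    Tendsto (fun R : ℝ => P.real {ω | (markedSup (closedBallSup h R) (Φ ω)).toReal /
      normalisation h G lam ξ R ≤ s}) atTop (𝓝 (Real.exp (-s ^ (-ξ)))) := by
  have hint := tendsto_intensity hd hξ hlam hG hne hdecay hs
  have hexp := ((ENNReal.tendsto_toReal ENNReal.ofReal_ne_top).comp hint).neg.rexp
  rw [ENNReal.toReal_ofReal (Real.rpow_nonneg hs.le _)] at hexp
  refine hexp.congr' ?_
  filter_upwards [hint.eventually (gt_mem_nhds ENNReal.ofReal_lt_top), eventually_gt_atTop 0,
    eventually_normalisation_pos hd hlam hG hne hdecay] with R hRfin hR hN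
  simp only [Function.comp]
  rw [← markedSup_law hΦ (measurable_ballSup h R) _ hRfin.ne]
  refine measureReal_congr ?_
  filter_upwards [ae_markedSup_closedBallSup_lt_top hξ hlam hG hne hdecay hΦ R,
    markedSup_ae_congr hΦ (closedBallSup_ae_eq_ballSup volume h hR)] with ω h1 h2
  refine propext ?_
  change markedSup (ballSup h R) (Φ ω) ≤ _ ↔ (markedSup (closedBallSup h R) (Φ ω)).toReal /
      normalisation h G lam ξ R ≤ s
  rw [← h2, div_le_iff₀ hN, ENNReal.le_ofReal_iff_toReal_le h1.ne (by positivity), mul_comm]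

lemma tendsto_distribution (hd : 0 < d) (hξ : 0 < ξ) (hlam : 0 < lam)
    (hG : IsRegularlyVarying (tail G) (-ξ)) (hne : ∃ x, h x ≠ 0) (hdecay : DecayCondition ξ h)
    (hΦ : IsPoissonPointProcess Φ
      ((volume : Measure (EuclideanSpace ℝ (Fin d))).prod (ENNReal.ofReal lam • G)) P) (s : ℝ) :
    Tendsto (fun R : ℝ => P.real {ω | (markedSup (closedBallSup h R) (Φ ω)).toReal /
      normalisation h G lam ξ R ≤ s}) atTop (𝓝 (frechetFun ξ s)) := by
  rcases lt_or_ge 0 s with hs | hs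
  · rw [frechetFun, if_pos hs]
    exact tendsto_distribution_of_pos hd hξ hlam hG hne hdecay hΦ hs
  · rw [frechetFun, if_neg (not_lt.2 hs)]
    refine tendsto_order.2 ⟨fun b hb => Eventually.of_forall fun R =>
      hb.trans_le measureReal_nonneg, fun b hb => ?_⟩
    have hcont : Tendsto (frechetFun ξ) (𝓝[>] 0) (𝓝 (frechetFun ξ 0)) :=
      (frechetFun_rightCont hξ 0).mono_left (nhdsWithin_mono _ Set.Ioi_subset_Ici_self)
    -- For `s ≤ 0` monotonicity bounds the probability by its value at a small `u > 0`, whose limit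
    -- is below any prescribed `b > 0`.
    rw [show frechetFun ξ 0 = 0 by simp [frechetFun]] at hcont
    obtain ⟨u, hub, hu⟩ := ((hcont.eventually (gt_mem_nhds hb)).and self_mem_nhdsWithin).exists
    have hu0 : 0 < u := hu
    rw [frechetFun, if_pos hu0] at hub
    filter_upwards [(tendsto_distribution_of_pos hd hξ hlam hG hne hdecay hΦ hu0).eventually
      (gt_mem_nhds hub)] with R hR
    refine lt_of_le_of_lt (measureReal_mono fun ω hω => ?_) hR
    exact le_trans hω (hs.trans hu0.le)

end Limit

/-! ### Identification of the Fréchet limit and conclusion -/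

lemma frechetLaw_real_Iic {ξ : ℝ} (hξ : 0 < ξ) (x : ℝ) :
    (frechetLaw ξ hξ : Measure ℝ).real (Set.Iic x) = frechetFun ξ x := by
  change ((frechetCDF ξ hξ).measure).real (Set.Iic x) = _
  rw [measureReal_def, StieltjesFunction.measure_Iic _ (frechetCDF_tendsto_atBot ξ hξ), sub_zero]
  exact ENNReal.toReal_ofReal (frechetFun_nonneg ξ x)

end ShotNoise

theorem theorem3p4 {Ω : Type*} [MeasurableSpace Ω] (P : Measure Ω) [IsProbabilityMeasure P]
    (d : ℕ) (hd : 0 < d) (ξ : ℝ) (hξ : 0 < ξ) (lam : ℝ) (hlam : 0 < lam)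
    (G : Measure (Set.Ioi (0 : ℝ))) [IsProbabilityMeasure G]
    (hG : ShotNoise.IsRegularlyVarying (ShotNoise.tail G) (-ξ))
    (h : EuclideanSpace ℝ (Fin d) → ℝ≥0∞) (hmeas : Measurable h) (hne : ∃ x, h x ≠ 0)
    (hdecay : ShotNoise.DecayCondition ξ h)
    (Φ : Ω → Set (EuclideanSpace ℝ (Fin d) × Set.Ioi (0 : ℝ)))
    (hΦ : ShotNoise.IsPoissonPointProcess Φ
      ((volume : Measure (EuclideanSpace ℝ (Fin d))).prod (ENNReal.ofReal lam • G)) P) :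
    (∀ R : ℝ, ∀ᵐ ω ∂P,
      (⨆ y ∈ Metric.closedBall (0 : EuclideanSpace ℝ (Fin d)) R,
        ShotNoise.extremalShotNoise h (Φ ω) y) < ∞) ∧
    TendstoInDistribution
      (fun (R : ℝ) (ω : Ω) =>
        (⨆ y ∈ Metric.closedBall (0 : EuclideanSpace ℝ (Fin d)) R,
          ShotNoise.extremalShotNoise h (Φ ω) y).toReal / ShotNoise.normalisation h G lam ξ R)
      atTop (id : ℝ → ℝ) (fun _ => P) (ShotNoise.frechetLaw ξ hξ : Measure ℝ) := by
  simp only [ShotNoise.iSup_extremalShotNoise]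
  have hae : ∀ R : ℝ, AEMeasurable (fun ω =>
      (ShotNoise.markedSup (ShotNoise.closedBallSup h R) (Φ ω)).toReal /
        ShotNoise.normalisation h G lam ξ R) P := fun R =>
    (ShotNoise.aemeasurable_markedSup_closedBallSup hmeas hΦ R).ennreal_toReal.div_const _
  refine ⟨ShotNoise.ae_markedSup_closedBallSup_lt_top hξ hlam hG hne hdecay hΦ, hae,
    aemeasurable_id, ShotNoise.tendsto_of_forall_tendsto_Iic fun x => ?_⟩
  simp only [ProbabilityMeasure.coe_mk, Measure.map_id]
  rw [ShotNoise.frechetLaw_real_Iic hξ x]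
  refine (ShotNoise.tendsto_distribution hd hξ hlam hG hne hdecay hΦ x).congr fun R => ?_
  rw [measureReal_def, measureReal_def, Measure.map_apply_of_aemeasurable (hae R)
    measurableSet_Iic]
  rfl
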